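/- **Notation.** Let $k\ge 3$. Put $\delta=1$ if $k$ is odd and $\delta=2$ if $k$ is even. An $n$-tuple $\mathbf a\in\mathbb Z_k^n$ is *self-negative* if $-\mathbf a=\mathbf a$. For $n\ge2$, an $\mathcal{NAS}_k(n)$ of period $m$ is a periodic sequence $(s_i)_{i\ge0}$ over $\mathbb Z_k$ of period $m$ such that equality of the $n$-tuples of consecutive terms at positions $i,j$ implies $i\equiv j \pmod m$, and such that if an $n$-tuple occurs in it then its negative does not. It is *maximal* if its period is $(k^n-\delta^n)/2$, which is an upper bound for the period of every $\mathcal{NAS}_k(n)$. The de Bruijn digraph $B_k(n)$ has vertex set $\mathbb Z_k^n$ and, for each $(n+1)$-tuple $(x_0,\dots,x_n)$, an edge with that label from $(x_0,\dots,x_{n-1})$ to $(x_1,\dots,x_n)$. A digraph is *Eulerian* if it is connected and every vertex has in-degree equal to out-degree. A subgraph $T$ of $B_k(n)$ is *antinegative* if $(-\mathbf x,-\mathbf y)$ is not an edge of $T$ whenever $(\mathbf x,\mathbf y)$ is. Let $D(a_0,\dots,a_n)=(a_1-a_0,\dots,a_n-a_{n-1})$; for a subgraph $T$ of $B_k(n-1)$,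 $D^{-1}(T)$ is the subgraph of $B_k(n)$ whose vertices and edges are those mapped by $D$ to vertices and edges of $T$. Let $n\ge3$ be odd. For $\mathbf u\in\mathbb Z_k^n$ let $w^*(\mathbf u)=\sum_i f(u_i)\in\mathbb Q$, where $f(0)=k/2$ and $f(u)=u\in\{1,\dots,k-1\}$ for $u\ne0$. Group the non-self-negative $n$-tuples with $w^*=kn/2$ into classes (circuits) under cyclic shift, and select exactly one circuit from each pair consisting of a circuit and its negative. Let $W_k(n-1)$ be the subgraph of $B_k(n-1)$ whose edges are the $n$-tuples with $w^*<kn/2$ together with those in the selected circuits, and whose vertices are the endpoints of these edges. Let $T_k(n-1)$ be the subgraph of $B_k(n-1)$ whose edges are the $\delta^n$ self-negative $n$-tuples (with their endpoints), and let $\mathbf a=[a_0,\dots,a_{L-1}]$, $L=\delta^n$, be an Eulerian circuit of it, written as a periodic sequence whose consecutive $n$-tuples are the edges. For $x\in\mathbb Z_k$ let $\mathbf a_x$ be the circuit of $B_k(n)$ in $D^{-1}(\mathbf a)$ whose edges are the $(n+1)$-tuples of consecutive terms of the sequence $x,\ x+a_0,\ x+a_0+a_1,\dots$. Let $Z_k(n)$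 be the subgraph of $B_k(n)$ whose edges are those of $D^{-1}(W_k(n-1))$ and those of the circuits $\mathbf a_x$ for $0<x<k/2$, and whose vertices are the endpoints of these edges. **Theorem.** Let $k\ge3$. (a) Let $n\ge3$ be odd. A selection of circuits and an Eulerian circuit $\mathbf a$ as above exist. For every such selection and every such $\mathbf a$, $Z_k(n)$ is an antinegative Eulerian subgraph of $B_k(n)$ with $(k^{n+1}-\delta^{n+1})/2$ edges, and there is a maximal $\mathcal{NAS}_k(n+1)$ in which the $(n+1)$-tuples that occur are exactly the edges of $Z_k(n)$. (b) For every $n\ge2$ there exists a maximal $\mathcal{NAS}_k(n)$. -/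

import Mathlib

namespace NAS

/-! ### Negative avoiding sequences -/

/-- The `n`-tuple `(s_i, s_{i+1}, ..., s_{i+n-1})` occurring at position `i` of the sequence `s`. -/
def window {k : ℕ} (s : ℕ → ZMod k) (n i : ℕ) : Fin n → ZMod k := fun t => s (i + t)

/-- `s` is a periodic `k`-ary `n`-window sequence of period `m`: no `n`-tuple occurs twice in a
period. (The second clause forces `m` to be the least period of `s`.) -/
structure IsWindowSeq {k : ℕ} (n : ℕ) (s : ℕ → ZMod k) (m : ℕ) : Prop where
  pos : 0 < m
  periodic : ∀ i, s (i + m) = s i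
  inj : ∀ i j, window s n i = window s n j → i ≡ j [MOD m]

/-- `s` is a negative avoiding sequence of span `n` and period `m`: an `n`-window sequence such that
if an `n`-tuple occurs in `s` then its negative does not. -/
structure IsNAS {k : ℕ} (n : ℕ) (s : ℕ → ZMod k) (m : ℕ) : Prop extends IsWindowSeq n s m where
  avoids : ∀ a : Fin n → ZMod k, a ∈ Set.range (window s n) → -a ∉ Set.range (window s n)

/-- `δ = 1` if `k` is odd and `δ = 2` if `k` is even. -/
def delta (k : ℕ) : ℕ := if Odd k then 1 else 2

/-- The upper bound `(k^n - δ^n) / 2` on the period of a negative avoiding sequence. For `3 ≤ k` and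
`1 ≤ n`, the subtraction does not truncate and the division is exact,
see `NAS.two_mul_bound_add`. -/
def bound (k n : ℕ) : ℕ := (k ^ n - delta k ^ n) / 2

theorem two_mul_bound_add (k n : ℕ) (hk : 3 ≤ k) (hn : 1 ≤ n) :
    2 * bound k n + delta k ^ n = k ^ n := by
  have hle : delta k ^ n ≤ k ^ n := by
    apply Nat.pow_le_pow_left
    unfold delta
    split_ifs <;> omega
  have hev : Even (k ^ n - delta k ^ n) := by
    rw [Nat.even_sub hle]
    have hn' : n ≠ 0 := by omega
    unfold delta
    split_ifs with h
    · simp [Nat.even_pow, hn', h]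
    · simp [Nat.even_pow, hn', Nat.not_odd_iff_even.mp h]
  have := Nat.two_mul_div_two_of_even hev
  unfold bound
  omega

/-- `s` is a maximal negative avoiding sequence of span `n`: its period meets the bound. -/
def IsMaximalNAS {k : ℕ} (n : ℕ) (s : ℕ → ZMod k) : Prop := IsNAS n s (bound k n)

/-! ### Subgraphs of the de Bruijn digraph -/

/-- A subgraph of the de Bruijn digraph `B_k(n)`. The vertices of `B_k(n)` are the `k`-ary
`n`-tuples, and its edges are specified by their labels: every `(n+1)`-tuple
`e = (x_0, ..., x_n)` is an edge from `(x_0, ..., x_{n-1}) = Fin.init e` to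
`(x_1, ..., x_n) = Fin.tail e`. -/
structure Subgraph (k n : ℕ) where
  verts : Set (Fin n → ZMod k)
  edges : Set (Fin (n + 1) → ZMod k)
  init_mem : ∀ e ∈ edges, (Fin.init e : Fin n → ZMod k) ∈ verts
  tail_mem : ∀ e ∈ edges, (Fin.tail e : Fin n → ZMod k) ∈ verts

namespace Subgraph

variable {k n : ℕ}

/-- The subgraph with a given set of edges, whose vertices are the endpoints of these edges. -/
def ofEdges (E : Set (Fin (n + 1) → ZMod k)) : Subgraph k n where
  verts := {v | ∃ e ∈ E, Fin.init e = v ∨ Fin.tail e = v}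
  edges := E
  init_mem := fun e he => ⟨e, he, Or.inl rfl⟩
  tail_mem := fun e he => ⟨e, he, Or.inr rfl⟩

/-- There is an edge of `T` from `x` to `y`. -/
def Adj (T : Subgraph k n) (x y : Fin n → ZMod k) : Prop :=
  ∃ e ∈ T.edges, Fin.init e = x ∧ Fin.tail e = y

noncomputable def inDegree (T : Subgraph k n) (v : Fin n → ZMod k) : ℕ :=
  {e ∈ T.edges | Fin.tail e = v}.ncard

noncomputable def outDegree (T : Subgraph k n) (v : Fin n → ZMod k) : ℕ :=
  {e ∈ T.edges | Fin.init e = v}.ncard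

/-- Every vertex has in-degree equal to out-degree. -/
def IsBalanced (T : Subgraph k n) : Prop := ∀ v ∈ T.verts, T.inDegree v = T.outDegree v

/-- `T` is (weakly) connected: it has a vertex, and any two of its vertices are joined by a path in
which edges may be traversed in either direction. -/
def IsConnected (T : Subgraph k n) : Prop :=
  T.verts.Nonempty ∧ ∀ u ∈ T.verts, ∀ v ∈ T.verts, Relation.EqvGen T.Adj u v

/-- An Eulerian digraph is a connected balanced digraph. -/
def IsEulerian (T : Subgraph k n) : Prop := T.IsConnected ∧ T.IsBalanced

/-- If `(x, y)` is an edge of `T` then `(-x, -y)` is not. -/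
def IsAntinegative (T : Subgraph k n) : Prop := ∀ x y, T.Adj x y → ¬ T.Adj (-x) (-y)

/-- The sequence `a`, read with period `L`, is an Eulerian circuit of `T`: its consecutive
`(n+1)`-windows at positions `0, ..., L - 1` run through every edge of `T` exactly once. -/
structure IsEulerianCircuit (T : Subgraph k n) (a : ℕ → ZMod k) (L : ℕ) : Prop where
  pos : 0 < L
  periodic : ∀ i, a (i + L) = a i
  bijOn : Set.BijOn (window a (n + 1)) (Set.Iio L) T.edges

end Subgraph

/-! ### The Lempel homomorphism -/

/-- The Lempel map `D (a_0, ..., a_n) = (a_1 - a_0, ..., a_n - a_{n-1})`. -/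
def lempel {k n : ℕ} (a : Fin (n + 1) → ZMod k) : Fin n → ZMod k :=
  fun i => a i.succ - a i.castSucc

theorem lempel_init {k n : ℕ} (e : Fin (n + 2) → ZMod k) :
    lempel (Fin.init e : Fin (n + 1) → ZMod k) = Fin.init (lempel e) := rfl

theorem lempel_tail {k n : ℕ} (e : Fin (n + 2) → ZMod k) :
    lempel (Fin.tail e : Fin (n + 1) → ZMod k) = Fin.tail (lempel e) := rfl

/-- The Lempel pre-image `D⁻¹(T)`, a subgraph of `B_k(n+1)`, of a subgraph `T` of `B_k(n)`. -/
def lempelPreimage {k n : ℕ} (T : Subgraph k n) : Subgraph k (n + 1) where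
  verts := {v | lempel v ∈ T.verts}
  edges := {e | lempel e ∈ T.edges}
  init_mem := fun e he => by
    change lempel (Fin.init e) ∈ T.verts
    rw [lempel_init]
    exact T.init_mem _ he
  tail_mem := fun e he => by
    change lempel (Fin.tail e) ∈ T.verts
    rw [lempel_tail]
    exact T.tail_mem _ he

/-- The lift, starting at `x`, of the sequence `a` through `D`: the sequence
`x, x + a_0, x + a_0 + a_1, ...`, whose consecutive differences are the terms of `a`. -/
def lift {k : ℕ} (a : ℕ → ZMod k) (x : ZMod k) : ℕ → ZMod k :=
  fun i => x + ∑ j ∈ Finset.range i, a j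

/-! ### The graphs `W_k(n-1)` -/

/-- The function `f` with `f 0 = k / 2` and `f u = u ∈ {1, ..., k - 1}` for `u ≠ 0`. -/
def pseudovalue {k : ℕ} (u : ZMod k) : ℚ := if u = 0 then (k : ℚ) / 2 else (u.val : ℚ)

def pseudoweight {k n : ℕ} (u : Fin n → ZMod k) : ℚ := ∑ i, pseudovalue (u i)

/-- `E_k(n)`: the `n`-tuples of pseudoweight less than `nk/2`. -/
def lowTuples (k n : ℕ) : Set (Fin n → ZMod k) := {e | pseudoweight e < (n : ℚ) * k / 2}

/-- The (edge set of the) circuit `[a_0, ..., a_{n-1}]`: all cyclic shifts of the tuple. -/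
def circuit {k n : ℕ} (a : Fin n → ZMod k) : Set (Fin n → ZMod k) :=
  {b | ∃ c : ℕ, b = fun i => a ((finRotate n ^ c) i)}

/-- `C*_k(n-1)`: the circuits formed by `n`-tuples of pseudoweight exactly `nk/2` that contain no
self-negative `n`-tuple. -/
def midCircuits (k n : ℕ) : Set (Set (Fin n → ZMod k)) :=
  {C | (∃ a : Fin n → ZMod k, pseudoweight a = (n : ℚ) * k / 2 ∧ C = circuit a) ∧
    ∀ e ∈ C, -e ≠ e}

/-- The negative of a circuit. -/
def negCircuit {k n : ℕ} (C : Set (Fin n → ZMod k)) : Set (Fin n → ZMod k) :=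
  {e | -e ∈ C}

/-- `𝒮` consists of exactly one circuit from each pair `{C, -C}` of circuits in `C*_k(n-1)`. -/
def IsSelection (k n : ℕ) (𝒮 : Set (Set (Fin n → ZMod k))) : Prop :=
  𝒮 ⊆ midCircuits k n ∧ ∀ C ∈ midCircuits k n, (C ∈ 𝒮 ↔ negCircuit C ∉ 𝒮)

/-- `F_k(n)`, for the selection `𝒮`. -/
def edgesF (k n : ℕ) (𝒮 : Set (Set (Fin n → ZMod k))) : Set (Fin n → ZMod k) :=
  lowTuples k n ∪ ⋃₀ 𝒮

/-- `W_k(m)`, the subgraph of `B_k(m)` with edge set `F_k(m+1)`. -/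
def graphW (k m : ℕ) (𝒮 : Set (Set (Fin (m + 1) → ZMod k))) : Subgraph k m :=
  Subgraph.ofEdges (edgesF k (m + 1) 𝒮)

/-! ### The graphs `Z_k(n)` -/

/-- `T_k(m)`, the subgraph of `B_k(m)` whose edges are the self-negative `(m+1)`-tuples. -/
def graphT (k m : ℕ) : Subgraph k m := Subgraph.ofEdges {e | -e = e}

/-- The edges of the circuit `a_x` of `B_k(n)`, the lift starting at `x` of a circuit `a` of
`B_k(n-1)`. -/
def liftedCircuit {k : ℕ} (n : ℕ) (a : ℕ → ZMod k) (x : ZMod k) : Set (Fin (n + 1) → ZMod k) :=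
  Set.range (window (lift a x) (n + 1))

/-- `Z_k(n)` with `n = m + 1`: the subgraph of `B_k(n)` whose edges are those of `D⁻¹(W_k(n-1))` and
those of the circuits `a_x` with `0 < x < k/2`. -/
def graphZ (k m : ℕ) (𝒮 : Set (Set (Fin (m + 1) → ZMod k))) (a : ℕ → ZMod k) :
    Subgraph k (m + 1) :=
  Subgraph.ofEdges ((lempelPreimage (graphW k m 𝒮)).edges ∪
    {e | ∃ x : ℕ, 0 < x ∧ 2 * x < k ∧ e ∈ liftedCircuit (m + 1) a (x : ZMod k)})

end NAS

/-! Choose a set of edges containing exactly one of `e`, `-e` for each non-self-negative tuple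
(`IsHalf`). It has the required number of edges and is antinegative, and an Eulerian circuit through
it, read as a sequence, is a maximal negative avoiding sequence (`Subgraph.exists_isMaximalNAS`). So
each graph needs three facts: the half property, balance and connectedness.

Balance is obtained from an explicit injective successor map on edges (`HasSuccession`). Euler's
theorem then follows by merging cycles of the resulting permutation (`exists_cyclic_succession`).

For `W`, negation turns weight `w` into `nk - w`, so low tuples are opposite to high ones. In the
middle weight, a circuit of odd length equals its negative only if its tuples are self-negative, so
a selection splits the rest in half. The edge set is closed under rotation, which is the successor
map. It is connected because 1 has the least pseudovalue: appending 1 again and again never leaves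
the edge set and ends at the constant tuple 1.

For `Z`, the map `D` commutes with negation, so over non-self-negative tuples the half property is
inherited from `W`. Over self-negative tuples the terms of `a` sum to zero in a period
(`Subgraph.IsEulerianCircuit.sum_eq_zero`). The lifts `a_x` are therefore disjoint circuits of
length `L` with `-a_x = a_{-x}`, and taking `0 < x < k/2` keeps one of each pair. Walks along 1s
lift to arithmetic progressions of step 1, which all reach `(0, 1, 2, ...)`.

Odd spans at least 3 come from `W`, even spans at least 4 from `Z`, and span 2 from an explicit
graph on `ℤ_k`. -/

namespace NAS

/-! ### Merging the cycles of a permutation -/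

section Merge

open Equiv Equiv.Perm

variable {α β : Type*}

/-- The transposition exchanges the successors of `e` and `f`, which splices two different cycles
into one: from `e` run through the old cycle of `f`, then through that of `e`. -/
theorem sameCycle_swap_mul [Finite α] [DecidableEq α] {σ : Perm α} {e f : α}
    (hf : ¬ σ.SameCycle e f) :
    (swap (σ e) (σ f) * σ).SameCycle e f ∧
      ∀ g, σ.SameCycle e g → (swap (σ e) (σ f) * σ).SameCycle e g := by
  set τ := swap (σ e) (σ f) * σ with hτ
  have hτe : τ e = σ f := by simp [hτ]
  have hτf : τ f = σ e := by simp [hτ]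
  have hτx : ∀ x, x ≠ e → x ≠ f → τ x = σ x := fun x h1 h2 => by
    rw [hτ, Perm.mul_apply, swap_apply_of_ne_of_ne] <;> simpa
  have h1 : ∀ j : ℕ, τ.SameCycle e ((σ ^ (j + 1)) f) := by
    intro j
    induction j with
    | zero => simpa [← hτe] using SameCycle.refl τ e
    | succ j ih =>
      rw [pow_succ', Perm.mul_apply]
      have hne : (σ ^ (j + 1)) f ≠ e := fun h => hf (SameCycle.symm ⟨(j + 1 : ℕ), by rwa [zpow_natCast]⟩)
      by_cases h : (σ ^ (j + 1)) f = f
      · rw [h, ← hτe]; simpa using SameCycle.refl τ e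
      · rw [← hτx _ hne h]; simpa using ih
  have hef : τ.SameCycle e f := by
    -- With this exponent the walk has gone all the way round and stands at `f`.
    have := h1 (orderOf σ - 1)
    rwa [Nat.sub_add_cancel (orderOf_pos σ), pow_orderOf_eq_one, Perm.one_apply] at this
  have h2 : ∀ j : ℕ, τ.SameCycle e ((σ ^ (j + 1)) e) := by
    intro j
    induction j with
    | zero => simpa [← hτf] using hef
    | succ j ih =>
      rw [pow_succ', Perm.mul_apply]
      have hne : (σ ^ (j + 1)) e ≠ f := fun h => hf ⟨(j + 1 : ℕ), by rwa [zpow_natCast]⟩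
      by_cases h : (σ ^ (j + 1)) e = e
      · rw [h, ← hτf]; simpa using hef
      · rw [← hτx _ h hne]; simpa using ih
  refine ⟨hef, fun g hg => ?_⟩
  obtain ⟨i, hi, -, rfl⟩ := hg.exists_pow_eq''
  simpa [Nat.sub_add_cancel hi] using h2 (i - 1)

/-- Euler's theorem, for a digraph with edge set `α` and endpoint maps `hd` and `tl`. -/
theorem exists_cyclic_succession [Finite α] (hd tl : α → β) {σ : Perm α}
    (hσ : ∀ e, hd (σ e) = tl e)
    (hconn : ∀ e f, Relation.EqvGen (fun x y => ∃ g, hd g = x ∧ tl g = y) (tl e) (tl f)) :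
    ∃ τ : Perm α, (∀ e, hd (τ e) = tl e) ∧ ∀ e f, τ.SameCycle e f := by
  classical
  cases isEmpty_or_nonempty α with
  | inl h => exact ⟨σ, hσ, fun e => h.elim e⟩
  | inr h =>
  obtain ⟨e₀⟩ := h
  obtain ⟨τ, hτ, hmax⟩ := Set.exists_max_image {τ : Perm α | ∀ e, hd (τ e) = tl e}
    (fun τ => {f | τ.SameCycle e₀ f}.ncard) (Set.toFinite _) ⟨σ, hσ⟩
  refine ⟨τ, hτ, ?_⟩
  -- Two edges with the same end can exchange successors, so by maximality the cycle of `e₀`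
  -- contains both or neither.
  have merge : ∀ e f, tl e = tl f → τ.SameCycle e₀ e → τ.SameCycle e₀ f := by
    intro e f hef he
    by_contra hf
    have hef' : ¬ τ.SameCycle e f := fun h => hf (he.trans h)
    obtain ⟨h1, h2⟩ := sameCycle_swap_mul hef'
    set τ' := swap (τ e) (τ f) * τ with hτ'
    have hmem : ∀ x, hd (τ' x) = tl x := by
      intro x
      rw [hτ', Perm.mul_apply, swap_apply_def]
      split_ifs with ha hb
      · rw [hτ, ← hef, ← hτ x, ha, hτ]
      · rw [hτ, hef, ← hτ x, hb, hτ]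
      · exact hτ x
    refine absurd (hmax τ' hmem) (not_le.2 ?_)
    have h0 := (h2 _ he.symm).symm
    refine Set.ncard_lt_ncard ⟨fun g hg => h0.trans (h2 g (he.symm.trans hg)), fun hsub => ?_⟩
    exact hf (hsub (h0.trans h1))
  -- The property of being the end of an edge in the cycle of `e₀` passes along every edge in both
  -- directions, so connectedness spreads it everywhere.
  have key : ∀ x y, Relation.EqvGen (fun x y => ∃ g, hd g = x ∧ tl g = y) x y →
      ((∃ e, τ.SameCycle e₀ e ∧ tl e = x) ↔ ∃ e, τ.SameCycle e₀ e ∧ tl e = y) := by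
    intro x y hxy
    induction hxy with
    | refl => rfl
    | symm _ _ _ ih => exact ih.symm
    | trans _ _ _ _ _ ih1 ih2 => exact ih1.trans ih2
    | rel x y h =>
      obtain ⟨g, rfl, rfl⟩ := h
      have hg : hd g = tl (τ⁻¹ g) := by rw [← hτ, ← Perm.mul_apply, mul_inv_cancel, Perm.one_apply]
      constructor
      · rintro ⟨e, he, h⟩
        exact ⟨g, by simpa using merge e (τ⁻¹ g) (h.trans hg) he, rfl⟩
      · rintro ⟨e, he, h⟩
        exact ⟨τ⁻¹ g, by simpa using merge e g h he, hg.symm⟩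
  have all : ∀ f, τ.SameCycle e₀ f := fun f => by
    obtain ⟨e, he, h⟩ := (key _ _ (hconn e₀ f)).1 ⟨e₀, SameCycle.refl _ _, rfl⟩
    exact merge e f h he
  exact fun e f => (all e).symm.trans (all f)

end Merge

/-! ### Successions and Eulerian circuits -/

variable {k n : ℕ}

/-- `E` decomposes into circuits: some injection of `E` into itself maps every edge to an edge
that starts where it ends. -/
def HasSuccession (E : Set (Fin (n + 1) → ZMod k)) : Prop :=
  ∃ f : (Fin (n + 1) → ZMod k) → (Fin (n + 1) → ZMod k), Set.MapsTo f E E ∧ Set.InjOn f E ∧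
    ∀ e ∈ E, (Fin.init (f e) : Fin n → ZMod k) = Fin.tail e

theorem HasSuccession.union {E E' : Set (Fin (n + 1) → ZMod k)} (h : HasSuccession E)
    (h' : HasSuccession E') (hd : Disjoint E E') : HasSuccession (E ∪ E') := by
  classical
  obtain ⟨f, hf, hfi, hfs⟩ := h
  obtain ⟨f', hf', hfi', hfs'⟩ := h'
  have hE' : ∀ e ∈ E', e ∉ E := fun e he' he => Set.disjoint_left.1 hd he he'
  refine ⟨fun e => if e ∈ E then f e else f' e, ?_, ?_, ?_⟩
  · rintro e (he | he)
    · simp [he, hf he]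
    · simp [hE' e he, hf' he]
  · rintro e (he | he) e' (he' | he') heq
    · simp only [he, he', if_true] at heq
      exact hfi he he' heq
    · simp only [he, hE' e' he', if_true, if_false] at heq
      exact absurd (hf he) (heq ▸ hE' _ (hf' he'))
    · simp only [he', hE' e he, if_true, if_false] at heq
      exact absurd (hf he') (heq ▸ hE' _ (hf' he))
    · simp only [hE' e he, hE' e' he', if_false] at heq
      exact hfi' he he' heq
  · rintro e (he | he)
    · simp [he, hfs e he]
    · simp [hE' e he, hfs' e he]

theorem HasSuccession.exists_perm [NeZero k] {E : Set (Fin (n + 1) → ZMod k)}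
    (h : HasSuccession E) :
    ∃ σ : Equiv.Perm E, ∀ e, (Fin.init (σ e).1 : Fin n → ZMod k) = Fin.tail e.1 := by
  obtain ⟨f, hf, hfi, hfs⟩ := h
  exact ⟨Equiv.ofBijective (hf.restrict) (Finite.injective_iff_bijective.1
    ((Set.MapsTo.restrict_inj hf).2 hfi)), fun e => hfs e e.2⟩

/-- The successor permutation maps the edges ending at `v` bijectively onto those starting at `v`.
-/
theorem Subgraph.isBalanced_of_hasSuccession [NeZero k] {T : Subgraph k n}
    (h : HasSuccession T.edges) : T.IsBalanced := by
  obtain ⟨σ, hσ⟩ := h.exists_perm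
  intro v _
  refine Set.ncard_congr (fun e he => (σ ⟨e, he.1⟩).1) (fun e he => ⟨(σ _).2, ?_⟩) ?_ ?_
  · rw [hσ]; exact he.2
  · intro e e' he he' heq
    simpa using σ.injective (Subtype.ext heq)
  · rintro e ⟨he, hv⟩
    refine ⟨(σ.symm ⟨e, he⟩).1, ⟨Subtype.prop _, ?_⟩, by simp⟩
    rw [← hσ, Equiv.apply_symm_apply]; exact hv

theorem init_window (s : ℕ → ZMod k) (i : ℕ) :
    (Fin.init (window s (n + 1) i) : Fin n → ZMod k) = window s n i := rfl

theorem tail_window (s : ℕ → ZMod k) (i : ℕ) :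
    (Fin.tail (window s (n + 1) i) : Fin n → ZMod k) = window s n (i + 1) := by
  ext t
  simp only [Fin.tail, window, Fin.val_succ]
  congr 1; omega

/-- Length at least two matters: a 1-tuple is seen by neither `Fin.init` nor `Fin.tail`. -/
theorem tuple_ext {α : Type*} {e e' : Fin (n + 2) → α}
    (h1 : (Fin.init e : Fin (n + 1) → α) = Fin.init e')
    (h2 : (Fin.tail e : Fin (n + 1) → α) = Fin.tail e') : e = e' := by
  ext t
  induction t using Fin.cases with
  | zero => exact congrFun h1 0
  | succ t => exact congrFun h2 t

theorem window_eq_of_modEq {s : ℕ → ZMod k} {L : ℕ} (hs : ∀ i, s (i + L) = s i) {i j : ℕ}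
    (h : i ≡ j [MOD L]) : window s n i = window s n j := by
  ext t
  have hp : Function.Periodic s L := hs
  change s (i + t) = s (j + t)
  rw [← hp.map_mod_nat (i + t), ← hp.map_mod_nat (j + t)]
  exact congrArg s (Nat.ModEq.add_right _ h)

theorem Subgraph.isEulerianCircuit_iff {T : Subgraph k n} {a : ℕ → ZMod k} {L : ℕ} :
    T.IsEulerianCircuit a L ↔
      IsWindowSeq (n + 1) a L ∧ Set.range (window a (n + 1)) = T.edges := by
  constructor
  · rintro ⟨hL, hp, hmap, hinj, hsurj⟩
    have hmod : ∀ i, window a (n + 1) i = window a (n + 1) (i % L) := fun i =>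
      window_eq_of_modEq hp (Nat.mod_modEq i L).symm
    refine ⟨⟨hL, hp, fun i j hij => ?_⟩, Set.Subset.antisymm ?_ ?_⟩
    · rw [hmod i, hmod j] at hij
      exact hinj (Nat.mod_lt _ hL) (Nat.mod_lt _ hL) hij
    · rintro _ ⟨i, rfl⟩
      rw [hmod i]
      exact hmap (Nat.mod_lt _ hL)
    · intro e he
      obtain ⟨i, -, rfl⟩ := hsurj he
      exact ⟨i, rfl⟩
  · rintro ⟨⟨hL, hp, hinj⟩, hr⟩
    refine ⟨hL, hp, fun i _ => hr ▸ ⟨i, rfl⟩, fun i hi j hj hij => ?_, fun e he => ?_⟩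
    · exact Nat.ModEq.eq_of_lt_of_lt (hinj i j hij) hi hj
    · obtain ⟨i, rfl⟩ := hr ▸ he
      exact ⟨i % L, Nat.mod_lt _ hL, window_eq_of_modEq hp (Nat.mod_modEq i L)⟩

/-- The sequence records the first entry of each edge along a cyclic succession. Consecutive edges
overlap, so the window at position `i` is the `i`-th edge itself. -/
theorem Subgraph.IsConnected.exists_windowSeq [NeZero k] {T : Subgraph k (n + 1)}
    (hc : T.IsConnected) (hs : HasSuccession T.edges) (hne : T.edges.Nonempty) :
    ∃ s : ℕ → ZMod k, IsWindowSeq (n + 2) s T.edges.ncard ∧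
      Set.range (window s (n + 2)) = T.edges := by
  classical
  obtain ⟨σ, hσ⟩ := hs.exists_perm
  obtain ⟨τ, hτ, hcyc⟩ := exists_cyclic_succession
    (fun e : T.edges => (Fin.init e.1 : Fin (n + 1) → ZMod k)) (fun e => Fin.tail e.1) hσ (by
      intro e f
      refine (hc.2 _ (T.tail_mem e e.2) _ (T.tail_mem f f.2)).mono ?_
      rintro x y ⟨g, hg, hx, hy⟩
      exact ⟨⟨g, hg⟩, hx, hy⟩)
  obtain ⟨e₀, he₀⟩ := hne
  set e : ℕ → T.edges := fun i => (τ ^ i) ⟨e₀, he₀⟩ with he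
  have hstep : ∀ i, (Fin.init (e (i + 1)).1 : Fin (n + 1) → ZMod k) = Fin.tail (e i).1 := fun i => by
    simp only [he, pow_succ', Equiv.Perm.mul_apply]
    exact hτ _
  have hwin : ∀ i, window (fun j => (e j).1 0) (n + 2) i = (e i).1 := by
    have : ∀ t : ℕ, ∀ ht : t < n + 2, ∀ i, (e (i + t)).1 0 = (e i).1 ⟨t, ht⟩ := by
      intro t
      induction t with
      | zero => intro _ i; rfl
      | succ t ih =>
        intro ht i
        have h1 := ih (by omega) (i + 1)
        have h2 := congrFun (hstep i) ⟨t, by omega⟩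
        simp only [Fin.init, Fin.tail, Fin.castSucc_mk, Fin.succ_mk] at h2
        rw [← h2, ← h1, show i + (t + 1) = i + 1 + t by omega]
    intro i
    ext t
    exact this t t.2 i
  have hcard : (Finset.univ : Finset T.edges).card = T.edges.ncard := by
    rw [Finset.card_univ, Set.ncard_eq_toFinset_card', Set.toFinset_card]
  have hon : τ.IsCycleOn ((Finset.univ : Finset T.edges) : Set T.edges) :=
    ⟨by simp, fun x _ y _ => hcyc x y⟩
  have hmod : ∀ i j, e i = e j ↔ i ≡ j [MOD T.edges.ncard] := fun i j => by
    rw [← hcard]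
    exact hon.pow_apply_eq_pow_apply (Finset.mem_univ _)
  refine ⟨fun j => (e j).1 0, ⟨?_, fun i => ?_, fun i j hij => ?_⟩, Set.Subset.antisymm ?_ ?_⟩
  · rw [Set.ncard_pos]; exact ⟨e₀, he₀⟩
  · rw [(hmod (i + T.edges.ncard) i).2 (by simp [Nat.ModEq])]
  · rw [hwin, hwin] at hij
    exact (hmod i j).1 (Subtype.ext hij)
  · rintro _ ⟨i, rfl⟩
    rw [hwin]; exact (e i).2
  · intro f hf
    obtain ⟨i, -, hi⟩ := hon.exists_pow_eq (Finset.mem_univ (⟨e₀, he₀⟩ : T.edges))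
      (Finset.mem_univ (⟨f, hf⟩ : T.edges))
    exact ⟨i, by rw [hwin]; exact congrArg Subtype.val hi⟩

/-! ### Half systems -/

/-- `E` contains exactly one of every tuple and its negative, and no self-negative tuple. -/
def IsHalf (E : Set (Fin n → ZMod k)) : Prop :=
  (∀ e ∈ E, -e ≠ e) ∧ ∀ e, -e ≠ e → (e ∈ E ↔ -e ∉ E)

theorem IsHalf.neg_notMem {E : Set (Fin n → ZMod k)} (h : IsHalf E) {e : Fin n → ZMod k}
    (he : e ∈ E) : -e ∉ E := (h.2 e (h.1 e he)).1 he

theorem ncard_neg_eq_self (hk : 3 ≤ k) : {u : ZMod k | -u = u}.ncard = delta k := by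
  have : NeZero k := ⟨by omega⟩
  unfold delta
  split_ifs with h
  · rw [Set.ncard_eq_one]
    refine ⟨0, ?_⟩
    ext u
    simp only [Set.mem_ofPred_eq, Set.mem_singleton_iff, ZMod.neg_eq_self_iff]
    constructor
    · rintro (h0 | h0)
      · exact h0
      · exact absurd h (by rw [← h0]; simp)
    · exact Or.inl
  · obtain ⟨q, hq⟩ := Nat.not_odd_iff_even.1 h
    have hv : ((q : ℕ) : ZMod k).val = q := ZMod.val_cast_of_lt (by omega)
    rw [Set.ncard_eq_two]
    refine ⟨0, (q : ZMod k), fun h0 => ?_, ?_⟩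
    · rw [← h0, ZMod.val_zero] at hv; omega
    · ext u
      simp only [Set.mem_ofPred_eq, Set.mem_insert_iff, Set.mem_singleton_iff,
        ZMod.neg_eq_self_iff]
      refine or_congr Iff.rfl ⟨fun h0 => ZMod.val_injective k (by omega), ?_⟩
      rintro rfl
      omega

theorem ncard_selfNegative (hk : 3 ≤ k) : {e : Fin n → ZMod k | -e = e}.ncard = delta k ^ n := by
  have : NeZero k := ⟨by omega⟩
  rw [← ncard_neg_eq_self hk, ← Nat.card_coe_set_eq, ← Nat.card_coe_set_eq]
  rw [Nat.card_congr (β := Fin n → {u : ZMod k | -u = u})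
    ⟨fun e i => ⟨e.1 i, congrFun e.2 i⟩, fun e => ⟨fun i => (e i).1, funext fun i => (e i).2⟩,
      fun _ => rfl, fun _ => rfl⟩, Nat.card_fun]
  simp

/-- All tuples split disjointly into `E`, `-E` and the `δ^n` self-negative ones. -/
theorem IsHalf.ncard_eq (hk : 3 ≤ k) (hn : 1 ≤ n) {E : Set (Fin n → ZMod k)} (h : IsHalf E) :
    E.ncard = bound k n := by
  have : NeZero k := ⟨by omega⟩
  have h1 : (-E).ncard = E.ncard := by
    rw [← Set.image_neg_eq_neg, Set.ncard_image_of_injective _ neg_injective]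
  have hd : Disjoint E (-E) := Set.disjoint_left.2 fun e he he' => h.neg_notMem he he'
  have hd' : Disjoint (E ∪ -E) {e | -e = e} := by
    rw [Set.disjoint_left]
    rintro e (he | he) he'
    · exact h.1 e he he'
    · exact h.1 _ he (by rw [neg_neg]; exact he'.symm)
  have hu : (E ∪ -E) ∪ {e | -e = e} = Set.univ := by
    rw [Set.eq_univ_iff_forall]
    intro e
    by_cases he : -e = e
    · exact Or.inr he
    · by_cases h0 : e ∈ E
      · exact Or.inl (Or.inl h0)
      · exact Or.inl (Or.inr (by_contra fun h' => h0 ((h.2 e he).2 h')))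
  have := congrArg Set.ncard hu
  rw [Set.ncard_union_eq hd', Set.ncard_union_eq hd, h1, ncard_selfNegative hk, Set.ncard_univ,
    Nat.card_fun] at this
  simp only [Nat.card_eq_fintype_card, ZMod.card, Fintype.card_fin] at this
  have := two_mul_bound_add k n hk hn
  omega

theorem bound_pos (hk : 3 ≤ k) (hn : 1 ≤ n) : 0 < bound k n := by
  have h := two_mul_bound_add k n hk hn
  have : delta k ^ n < k ^ n :=
    Nat.pow_lt_pow_left (by unfold delta; split_ifs <;> omega) (by omega)
  omega

theorem Subgraph.isAntinegative_of_isHalf {T : Subgraph k (n + 1)} (h : IsHalf T.edges) :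
    T.IsAntinegative := by
  rintro x y ⟨e, he, rfl, rfl⟩ ⟨e', he', h1, h2⟩
  have : e' = -e := tuple_ext h1 h2
  exact h.neg_notMem he (this ▸ he')

theorem Subgraph.exists_isMaximalNAS (hk : 3 ≤ k) {T : Subgraph k (n + 1)} (hh : IsHalf T.edges)
    (hs : HasSuccession T.edges) (hc : T.IsConnected) :
    ∃ s : ℕ → ZMod k, IsMaximalNAS (n + 2) s ∧ Set.range (window s (n + 2)) = T.edges := by
  have : NeZero k := ⟨by omega⟩
  have hcard := hh.ncard_eq hk (by omega)
  have hne : T.edges.Nonempty := by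
    rw [← Set.ncard_pos, hcard]
    exact bound_pos hk (by omega)
  obtain ⟨s, hs, hr⟩ := hc.exists_windowSeq hs hne
  refine ⟨s, ⟨hcard ▸ hs, fun a ha => ?_⟩, hr⟩
  rw [hr] at ha ⊢
  exact hh.neg_notMem ha

/-! ### Rotation -/

/-- The cyclic shift of a tuple. -/
def rotate (e : Fin n → ZMod k) : Fin n → ZMod k := fun i => e (finRotate n i)

theorem rotate_injective : Function.Injective (rotate : (Fin n → ZMod k) → Fin n → ZMod k) :=
  fun _ _ h => (finRotate n).surjective.injective_comp_right h

theorem init_rotate (e : Fin (n + 1) → ZMod k) :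
    (Fin.init (rotate e) : Fin n → ZMod k) = Fin.tail e := by
  ext i
  simp [Fin.init, Fin.tail, rotate]

theorem rotate_snoc (v : Fin (n + 1) → ZMod k) (x : ZMod k) :
    rotate (Fin.snoc v x : Fin (n + 2) → ZMod k) =
      Fin.snoc (Fin.tail (Fin.snoc v x : Fin (n + 2) → ZMod k)) (v 0) := by
  refine tuple_ext (by rw [init_rotate, Fin.init_snoc]) ?_
  ext i
  induction i using Fin.lastCases with
  | last => simp [Fin.tail, rotate, Fin.snoc, Fin.last_add_one]
  | cast i =>
    have h := congrFun (init_rotate (Fin.snoc v x : Fin (n + 2) → ZMod k)) i.succ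
    rw [Fin.tail, Fin.tail, Fin.succ_castSucc, Fin.snoc_castSucc]
    exact h

/-- Rotation sends an edge to one starting where it ends, so closure under rotation alone gives
balance. -/
theorem hasSuccession_of_rotate {E : Set (Fin (n + 1) → ZMod k)}
    (h : ∀ e ∈ E, rotate e ∈ E) : HasSuccession E :=
  ⟨rotate, h, rotate_injective.injOn, fun e _ => init_rotate e⟩

theorem rotate_mem_circuit {a e : Fin n → ZMod k} (h : e ∈ circuit a) : rotate e ∈ circuit a := by
  obtain ⟨c, rfl⟩ := h
  exact ⟨c + 1, by ext i; simp [rotate, pow_succ]⟩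

theorem negCircuit_circuit (a : Fin n → ZMod k) : negCircuit (circuit a) = circuit (-a) := by
  ext e
  constructor
  · rintro ⟨c, h⟩
    exact ⟨c, by rw [← neg_neg e, h]; rfl⟩
  · rintro ⟨c, rfl⟩
    exact ⟨c, by ext i; simp⟩

theorem negCircuit_negCircuit (C : Set (Fin n → ZMod k)) : negCircuit (negCircuit C) = C := by
  ext e; simp [negCircuit]

theorem mem_circuit_self (a : Fin n → ZMod k) : a ∈ circuit a := ⟨0, rfl⟩

theorem circuit_eq_of_mem {a b : Fin n → ZMod k} (h : b ∈ circuit a) : circuit b = circuit a := by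
  obtain ⟨c, rfl⟩ := h
  ext e
  constructor
  · rintro ⟨d, rfl⟩
    exact ⟨c + d, by ext i; simp [pow_add]⟩
  · rintro ⟨d, rfl⟩
    have hpos := orderOf_pos (finRotate n)
    -- Adding `c` full turns keeps the subtraction of `c` from truncating.
    obtain ⟨t, ht⟩ : ∃ t, c + t = d + c * orderOf (finRotate n) := by
      refine ⟨d + c * orderOf (finRotate n) - c, ?_⟩
      have := Nat.le_mul_of_pos_right c hpos
      omega
    refine ⟨t, ?_⟩
    ext i
    change a ((finRotate n ^ d) i) = a ((finRotate n ^ c) ((finRotate n ^ t) i))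
    rw [← Equiv.Perm.mul_apply, ← pow_add, ht, pow_add, mul_comm c, pow_mul, pow_orderOf_eq_one,
      one_pow, mul_one]

/-- A tuple of odd length whose negative is a cyclic shift of it is self-negative. -/
theorem neg_eq_self_of_neg_mem_circuit (hn : Odd n) {a : Fin n → ZMod k} (h : -a ∈ circuit a) :
    -a = a := by
  obtain ⟨c, h⟩ := h
  have hc : ∀ j : ℕ, ∀ i, a (((finRotate n ^ c) ^ j) i) = (-1) ^ j * a i := by
    intro j
    induction j with
    | zero => simp
    | succ j ih =>
      intro i
      rw [pow_succ, Equiv.Perm.mul_apply, ih, ← congrFun h i]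
      simp [pow_succ]
  have hord : (finRotate n) ^ n = 1 := by
    obtain ⟨m, rfl⟩ : ∃ m, n = m + 1 := ⟨n - 1, by have := hn.pos; omega⟩
    obtain _ | m := m
    · ext i; omega
    · have := pow_orderOf_eq_one (finRotate (m + 2))
      rwa [isCycle_finRotate.orderOf, support_finRotate, Finset.card_univ, Fintype.card_fin] at this
  ext i
  -- After `n` repetitions the rotation is trivial while the sign is `(-1)^n = -1`.
  have := hc n i
  rw [← pow_mul, mul_comm, pow_mul, hord, one_pow, hn.neg_one_pow] at this
  simpa using this.symm

/-! ### Pseudoweight -/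

/-- The value `k/2` at 0 is what makes this hold for 0 as well. -/
theorem pseudovalue_neg [NeZero k] (u : ZMod k) : pseudovalue (-u) = k - pseudovalue u := by
  unfold pseudovalue
  by_cases h : u = 0
  · simp only [h, neg_zero, if_true]; ring
  · have : u.val ≤ k := (ZMod.val_lt u).le
    simp [h, ZMod.neg_val, Nat.cast_sub this]

theorem pseudoweight_neg [NeZero k] (u : Fin n → ZMod k) :
    pseudoweight (-u) = n * k - pseudoweight u := by
  simp [pseudoweight, pseudovalue_neg, Finset.sum_sub_distrib]

theorem pseudoweight_rotate (u : Fin n → ZMod k) : pseudoweight (rotate u) = pseudoweight u :=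
  Equiv.sum_comp (finRotate n) fun i => pseudovalue (u i)

theorem pseudoweight_pow_rotate (u : Fin n → ZMod k) (c : ℕ) :
    pseudoweight (fun i => u ((finRotate n ^ c) i)) = pseudoweight u :=
  Equiv.sum_comp (finRotate n ^ c) fun i => pseudovalue (u i)

theorem pseudoweight_snoc (v : Fin n → ZMod k) (x : ZMod k) :
    pseudoweight (Fin.snoc v x : Fin (n + 1) → ZMod k) = pseudoweight v + pseudovalue x := by
  simp [pseudoweight, Fin.sum_univ_castSucc]

theorem pseudovalue_one (hk : 3 ≤ k) : pseudovalue (1 : ZMod k) = 1 := by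
  have : Fact (1 < k) := ⟨by omega⟩
  simp [pseudovalue, ZMod.val_one]

/-- Since `k/2 > 1`, the symbol 0 no longer has the least value and 1 takes its place. The
connectedness of `W` and `Z` rests on this. -/
theorem pseudovalue_one_lt (hk : 3 ≤ k) {x : ZMod k} (hx : x ≠ 1) :
    pseudovalue (1 : ZMod k) < pseudovalue x := by
  have : NeZero k := ⟨by omega⟩
  have : Fact (1 < k) := ⟨by omega⟩
  rw [pseudovalue_one hk, pseudovalue]
  have hk' : (3 : ℚ) ≤ k := by exact_mod_cast hk
  split_ifs with h
  · linarith
  · have h0 : x.val ≠ 0 := by rwa [Ne, ZMod.val_eq_zero]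
    have h1 : x.val ≠ 1 := fun h1 => hx (ZMod.val_injective k (by rw [h1, ZMod.val_one]))
    exact_mod_cast (by omega : 1 < x.val)

theorem pseudoweight_of_neg_eq_self [NeZero k] {u : Fin n → ZMod k} (h : -u = u) :
    pseudoweight u = n * k / 2 := by
  have := pseudoweight_neg u
  rw [h] at this
  linarith

/-! ### Selections of circuits -/

theorem negCircuit_mem_midCircuits [NeZero k] {C : Set (Fin n → ZMod k)}
    (hC : C ∈ midCircuits k n) : negCircuit C ∈ midCircuits k n := by
  obtain ⟨⟨a, ha, rfl⟩, h⟩ := hC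
  refine ⟨⟨-a, ?_, negCircuit_circuit a⟩, fun e he h' => h _ he (by rw [neg_neg, h'])⟩
  rw [pseudoweight_neg, ha]; ring

theorem negCircuit_ne (hn : Odd n) {C : Set (Fin n → ZMod k)}
    (hC : C ∈ midCircuits k n) : negCircuit C ≠ C := by
  obtain ⟨⟨a, ha, rfl⟩, h⟩ := hC
  intro heq
  have h1 : a ∈ negCircuit (circuit a) := (Set.ext_iff.1 heq a).2 (mem_circuit_self a)
  exact h a (mem_circuit_self a) (neg_eq_self_of_neg_mem_circuit hn h1)

theorem exists_isSelection [NeZero k] (hn : Odd n) :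
    ∃ 𝒮 : Set (Set (Fin n → ZMod k)), IsSelection k n 𝒮 := by
  -- A well-order on sets of tuples picks the smaller circuit of each pair; the two are distinct
  -- because `n` is odd.
  refine ⟨{C ∈ midCircuits k n | WellOrderingRel C (negCircuit C)}, fun C hC => hC.1,
    fun C hC => ⟨fun h h' => ?_, fun h => ⟨hC, ?_⟩⟩⟩
  · have := h'.2
    rw [negCircuit_negCircuit] at this
    exact asymm h.2 this
  · rcases trichotomous_of WellOrderingRel C (negCircuit C) with h' | h' | h'
    · exact h'
    · exact absurd h'.symm (negCircuit_ne hn hC)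
    · exact absurd ⟨negCircuit_mem_midCircuits hC, by rwa [negCircuit_negCircuit]⟩ h

/-- A self-negative tuple in the circuit would make the circuit its own negative, and then odd
length forces `e` to be self-negative. -/
theorem circuit_mem_midCircuits (hn : Odd n) [NeZero k] {e : Fin n → ZMod k}
    (hw : pseudoweight e = (n : ℚ) * k / 2) (he : -e ≠ e) : circuit e ∈ midCircuits k n := by
  refine ⟨⟨e, hw, rfl⟩, fun b hb hb' => he ?_⟩
  apply neg_eq_self_of_neg_mem_circuit hn
  have h1 := circuit_eq_of_mem hb
  rw [← h1, ← hb', ← negCircuit_circuit, h1]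
  change - -e ∈ circuit e
  rw [neg_neg]
  exact mem_circuit_self e

/-! ### The edge set `F_k(n)` -/

section EdgesF

variable {𝒮 : Set (Set (Fin n → ZMod k))}

theorem IsSelection.circuit_eq (h𝒮 : IsSelection k n 𝒮) {C : Set (Fin n → ZMod k)} (hC : C ∈ 𝒮)
    {e : Fin n → ZMod k} (he : e ∈ C) : circuit e = C := by
  obtain ⟨⟨a, -, rfl⟩, -⟩ := h𝒮.1 hC
  exact circuit_eq_of_mem he

theorem pseudoweight_of_mem_midCircuits {C : Set (Fin n → ZMod k)} (hC : C ∈ midCircuits k n)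
    {e : Fin n → ZMod k} (he : e ∈ C) : pseudoweight e = (n : ℚ) * k / 2 := by
  obtain ⟨⟨a, ha, rfl⟩, -⟩ := hC
  obtain ⟨c, rfl⟩ := he
  rw [pseudoweight_pow_rotate, ha]

theorem mem_edgesF_of_pseudoweight_eq (h𝒮 : IsSelection k n 𝒮) {e : Fin n → ZMod k}
    (hw : pseudoweight e = (n : ℚ) * k / 2) : e ∈ edgesF k n 𝒮 ↔ circuit e ∈ 𝒮 := by
  constructor
  · rintro (h | ⟨C, hC, he⟩)
    · exact absurd hw (ne_of_lt h)
    · rwa [h𝒮.circuit_eq hC he]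
  · exact fun h => Or.inr ⟨_, h, mem_circuit_self e⟩

theorem pseudoweight_le_of_mem_edgesF (h𝒮 : IsSelection k n 𝒮) {e : Fin n → ZMod k}
    (he : e ∈ edgesF k n 𝒮) : pseudoweight e ≤ (n : ℚ) * k / 2 := by
  rcases he with h | ⟨C, hC, he⟩
  · exact le_of_lt h
  · exact (pseudoweight_of_mem_midCircuits (h𝒮.1 hC) he).le

theorem isHalf_edgesF (hn : Odd n) [NeZero k] (h𝒮 : IsSelection k n 𝒮) :
    IsHalf (edgesF k n 𝒮) := by
  constructor
  · rintro e (h | ⟨C, hC, he⟩) hself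
    · exact absurd (pseudoweight_of_neg_eq_self hself) (ne_of_lt h)
    · exact (h𝒮.1 hC).2 e he hself
  · intro e he
    have hneg := pseudoweight_neg e
    rcases lt_trichotomy (pseudoweight e) ((n : ℚ) * k / 2) with h | h | h
    · refine iff_of_true (Or.inl h) fun h' => ?_
      have := pseudoweight_le_of_mem_edgesF h𝒮 h'
      linarith
    · rw [mem_edgesF_of_pseudoweight_eq h𝒮 h,
        mem_edgesF_of_pseudoweight_eq h𝒮 (e := -e) (by rw [hneg, h]; ring), ← negCircuit_circuit]
      exact h𝒮.2 _ (circuit_mem_midCircuits hn h he)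
    · refine iff_of_false (fun h' => ?_) (not_not.2 (Or.inl ?_))
      · exact absurd (pseudoweight_le_of_mem_edgesF h𝒮 h') (not_le.2 h)
      · change pseudoweight (-e) < _
        linarith

theorem rotate_mem_edgesF (h𝒮 : IsSelection k n 𝒮) {e : Fin n → ZMod k}
    (he : e ∈ edgesF k n 𝒮) : rotate e ∈ edgesF k n 𝒮 := by
  rcases he with h | ⟨C, hC, he⟩
  · left
    change pseudoweight (rotate e) < _
    rwa [pseudoweight_rotate]
  · refine Or.inr ⟨C, hC, ?_⟩
    have h1 := h𝒮.circuit_eq hC he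
    rw [← h1]
    exact rotate_mem_circuit (mem_circuit_self e)

end EdgesF

/-! ### Appending the symbol 1 -/

section Snoc

variable {𝒮 : Set (Set (Fin (n + 1) → ZMod k))}

/-- Replacing a last symbol other than 1 by 1 strictly lowers the weight, so the result is a low
tuple whatever the selection. -/
theorem snoc_one_mem_edgesF (hk : 3 ≤ k) (h𝒮 : IsSelection k (n + 1) 𝒮) {v : Fin n → ZMod k}
    {x : ZMod k} (h : (Fin.snoc v x : Fin (n + 1) → ZMod k) ∈ edgesF k (n + 1) 𝒮) :
    (Fin.snoc v 1 : Fin (n + 1) → ZMod k) ∈ edgesF k (n + 1) 𝒮 := by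
  by_cases hx : x = 1
  · exact hx ▸ h
  · left
    have h1 := pseudoweight_le_of_mem_edgesF h𝒮 h
    have h2 := pseudovalue_one_lt hk hx
    change pseudoweight _ < _
    rw [pseudoweight_snoc] at h1 ⊢
    linarith

theorem snoc_one_mem_edgesF_of_mem_verts (hk : 3 ≤ k) (h𝒮 : IsSelection k (n + 1) 𝒮)
    {v : Fin n → ZMod k} (hv : v ∈ (graphW k n 𝒮).verts) :
    (Fin.snoc v 1 : Fin (n + 1) → ZMod k) ∈ edgesF k (n + 1) 𝒮 := by
  have key : ∀ e ∈ edgesF k (n + 1) 𝒮,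
      (Fin.snoc (Fin.init e : Fin n → ZMod k) 1 : Fin (n + 1) → ZMod k) ∈ edgesF k (n + 1) 𝒮 :=
    fun e he => snoc_one_mem_edgesF hk h𝒮 (x := e (Fin.last n)) (by rwa [Fin.snoc_init_self])
  obtain ⟨e, he, rfl | rfl⟩ := hv
  · exact key e he
  · rw [← init_rotate]
    exact key _ (rotate_mem_edgesF h𝒮 he)

theorem snoc_one_mem_edgesF_of_neg_eq_self (hk : 3 ≤ k) {v : Fin n → ZMod k} (hv : -v = v) :
    (Fin.snoc v 1 : Fin (n + 1) → ZMod k) ∈ edgesF k (n + 1) 𝒮 := by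
  have : NeZero k := ⟨by omega⟩
  left
  change pseudoweight _ < _
  have hk' : (3 : ℚ) ≤ k := by exact_mod_cast hk
  rw [pseudoweight_snoc, pseudovalue_one hk, pseudoweight_of_neg_eq_self hv]
  push_cast
  linarith

end Snoc

/-- Rotation brings `v 0` to the last place, where it may be replaced by 1. Hence 1 can be appended
forever. -/
theorem tail_snoc_one_mem_edgesF (hk : 3 ≤ k) {𝒮 : Set (Set (Fin (n + 2) → ZMod k))}
    (h𝒮 : IsSelection k (n + 2) 𝒮) {v : Fin (n + 1) → ZMod k}
    (h : (Fin.snoc v 1 : Fin (n + 2) → ZMod k) ∈ edgesF k (n + 2) 𝒮) :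
    (Fin.snoc (Fin.tail (Fin.snoc v 1 : Fin (n + 2) → ZMod k)) 1 : Fin (n + 2) → ZMod k) ∈
      edgesF k (n + 2) 𝒮 := by
  apply snoc_one_mem_edgesF hk h𝒮 (x := v 0)
  rw [← rotate_snoc]
  exact rotate_mem_edgesF h𝒮 h

/-! ### Walks along a word -/

theorem snoc_window (s : ℕ → ZMod k) (i : ℕ) :
    (Fin.snoc (window s n i) (s (i + n)) : Fin (n + 1) → ZMod k) = window s (n + 1) i := by
  have := Fin.snoc_init_self (window s (n + 1) i)
  rwa [init_window] at this

theorem Subgraph.eqvGen_window {T : Subgraph k n} {s : ℕ → ZMod k}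
    (h : ∀ i, window s (n + 1) i ∈ T.edges) (i : ℕ) :
    Relation.EqvGen T.Adj (window s n 0) (window s n i) := by
  induction i with
  | zero => exact .refl _
  | succ i ih => exact ih.trans _ _ _ (.rel _ _ ⟨_, h i, init_window s i, tail_window s i⟩)

/-- The word is `u` followed by `c` forever; its windows form a walk inside `F` from `u` to the
constant tuple `c`. -/
theorem exists_word {F : Set (Fin (n + 1) → ZMod k)} {c : ZMod k} {u : Fin n → ZMod k}
    (hu : (Fin.snoc u c : Fin (n + 1) → ZMod k) ∈ F)
    (hF : ∀ v : Fin n → ZMod k, (Fin.snoc v c : Fin (n + 1) → ZMod k) ∈ F →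
      (Fin.snoc (Fin.tail (Fin.snoc v c : Fin (n + 1) → ZMod k)) c : Fin (n + 1) → ZMod k) ∈ F) :
    ∃ s : ℕ → ZMod k, window s n 0 = u ∧ (∀ i, n ≤ i → s i = c) ∧
      ∀ i, window s (n + 1) i ∈ F := by
  set s : ℕ → ZMod k := fun i => if h : i < n then u ⟨i, h⟩ else c with hs
  have h0 : window s n 0 = u := by
    ext t
    simp [window, hs]
  have h1 : ∀ i, n ≤ i → s i = c := fun i hi => by simp [hs, not_lt.2 hi]
  have h2 : ∀ i, (Fin.snoc (window s n i) c : Fin (n + 1) → ZMod k) = window s (n + 1) i :=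
    fun i => by rw [← snoc_window, h1 (i + n) (by omega)]
  refine ⟨s, h0, h1, fun i => ?_⟩
  induction i with
  | zero => rwa [← h2, h0]
  | succ i ih =>
    rw [← h2] at ih
    have := hF _ ih
    rwa [h2, tail_window, h2] at this

theorem window_eq_const {s : ℕ → ZMod k} {c : ZMod k} (h : ∀ i, n ≤ i → s i = c) :
    window s n n = fun _ => c := by
  ext t
  exact h _ (by omega)

/-! ### The graph `W_k(n-1)` -/

theorem isConnected_graphW (hk : 3 ≤ k) {𝒮 : Set (Set (Fin (n + 2) → ZMod k))}
    (h𝒮 : IsSelection k (n + 2) 𝒮) : (graphW k (n + 1) 𝒮).IsConnected := by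
  have key : ∀ v ∈ (graphW k (n + 1) 𝒮).verts,
      Relation.EqvGen (graphW k (n + 1) 𝒮).Adj v (fun _ => 1) := by
    intro v hv
    obtain ⟨s, rfl, h1, hs⟩ := exists_word (snoc_one_mem_edgesF_of_mem_verts hk h𝒮 hv)
      (fun v => tail_snoc_one_mem_edgesF hk h𝒮)
    rw [← window_eq_const h1]
    exact Subgraph.eqvGen_window hs _
  refine ⟨⟨0, _, snoc_one_mem_edgesF_of_neg_eq_self hk neg_zero, Or.inl (Fin.init_snoc _ _)⟩,
    fun u hu v hv => (key u hu).trans _ _ _ (key v hv).symm⟩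

/-! ### The graph `T_k(n-1)` -/

theorem rotate_mem_graphT {e : Fin (n + 1) → ZMod k} (h : e ∈ (graphT k n).edges) :
    rotate e ∈ (graphT k n).edges := by
  ext i
  exact congrFun h (finRotate (n + 1) i)

theorem neg_eq_self_of_mem_verts_graphT {v : Fin n → ZMod k} (h : v ∈ (graphT k n).verts) :
    -v = v := by
  obtain ⟨e, he, rfl | rfl⟩ := h
  · ext i; exact congrFun he i.castSucc
  · ext i; exact congrFun he i.succ

theorem neg_snoc_zero {v : Fin n → ZMod k} (h : -v = v) :
    -(Fin.snoc v 0 : Fin (n + 1) → ZMod k) = Fin.snoc v 0 := by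
  ext i
  induction i using Fin.lastCases with
  | last => simp
  | cast i => simpa using congrFun h i

theorem isConnected_graphT : (graphT k n).IsConnected := by
  have key : ∀ v ∈ (graphT k n).verts, Relation.EqvGen (graphT k n).Adj v (fun _ => 0) := by
    intro v hv
    obtain ⟨s, rfl, h1, hs⟩ := exists_word (F := (graphT k n).edges)
      (neg_snoc_zero (neg_eq_self_of_mem_verts_graphT hv)) (fun v hv =>
        neg_snoc_zero (neg_eq_self_of_mem_verts_graphT ((graphT k n).tail_mem _ hv)))
    rw [← window_eq_const h1]
    exact Subgraph.eqvGen_window hs _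
  exact ⟨⟨0, _, neg_snoc_zero neg_zero, Or.inl (Fin.init_snoc _ _)⟩,
    fun u hu v hv => (key u hu).trans _ _ _ (key v hv).symm⟩

theorem exists_isEulerianCircuit_graphT [NeZero k] :
    ∃ a L, (graphT k (n + 1)).IsEulerianCircuit a L := by
  obtain ⟨a, h⟩ := isConnected_graphT.exists_windowSeq
    (hasSuccession_of_rotate fun _ => rotate_mem_graphT)
    ⟨0, by change -(0 : Fin (n + 2) → ZMod k) = 0; exact neg_zero⟩
  exact ⟨a, _, Subgraph.isEulerianCircuit_iff.2 h⟩

/-! ### Lifts -/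

theorem lempel_neg (e : Fin (n + 1) → ZMod k) : lempel (-e) = -lempel e := by
  ext i; simp [lempel]; ring

theorem eq_of_lempel_eq {e e' : Fin (n + 1) → ZMod k} (h0 : e 0 = e' 0)
    (h : lempel e = lempel e') : e = e' := by
  ext i
  induction i using Fin.induction with
  | zero => exact h0
  | succ i ih =>
    have := congrFun h i
    simp only [lempel, ih] at this
    exact sub_left_injective this

theorem lift_succ (a : ℕ → ZMod k) (x : ZMod k) (i : ℕ) : lift a x (i + 1) = lift a x i + a i := by
  simp [lift, Finset.sum_range_succ, add_assoc]

theorem lempel_window_lift (a : ℕ → ZMod k) (x : ZMod k) (i : ℕ) :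
    lempel (window (lift a x) (n + 1) i) = window a n i := by
  ext t
  simp [lempel, window, ← add_assoc, lift_succ]

theorem exists_window_lift_eq {a : ℕ → ZMod k} {e : Fin (n + 1) → ZMod k} {i : ℕ}
    (h : lempel e = window a n i) : ∃ x, window (lift a x) (n + 1) i = e := by
  refine ⟨e 0 - lift a 0 i, eq_of_lempel_eq ?_ (by rw [lempel_window_lift, h])⟩
  simp [window, lift]

theorem lift_add_period {a : ℕ → ZMod k} {L : ℕ} (ha : ∀ i, a (i + L) = a i)
    (hsum : ∑ j ∈ Finset.range L, a j = 0) (x : ZMod k) (i : ℕ) :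
    lift a x (i + L) = lift a x i := by
  induction i with
  | zero => simp [lift, hsum]
  | succ i ih => rw [add_right_comm, lift_succ, lift_succ, ih, ha]

/-- `D` recovers the position modulo `L`. The zero sum gives every lift period `L`, so equal windows
also have equal starting values. -/
theorem window_lift_eq_iff {a : ℕ → ZMod k} {L : ℕ} (ha : IsWindowSeq n a L)
    (hsum : ∑ j ∈ Finset.range L, a j = 0) {x y : ZMod k} {i j : ℕ} :
    window (lift a x) (n + 1) i = window (lift a y) (n + 1) j ↔ i ≡ j [MOD L] ∧ x = y := by
  constructor
  · intro h
    have hij : i ≡ j [MOD L] := ha.inj _ _ (by rw [← lempel_window_lift a x, h, lempel_window_lift])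
    refine ⟨hij, ?_⟩
    rw [window_eq_of_modEq (lift_add_period ha.periodic hsum x) hij] at h
    have := congrFun h 0
    simpa [window, lift] using this
  · rintro ⟨h, rfl⟩
    exact window_eq_of_modEq (lift_add_period ha.periodic hsum x) h

theorem neg_lift {a : ℕ → ZMod k} (ha : ∀ i, -a i = a i) (x : ZMod k) (i : ℕ) :
    -lift a x i = lift a (-x) i := by
  simp only [lift, neg_add, ← Finset.sum_neg_distrib, ha]

/-- Adding `e 0` to the entry at place 1 pairs off the self-negative tuples with `e 0 ≠ 0`, and each
pair contributes `2 * e 0 = 0`. A second place is needed, hence length `n + 2`. -/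
theorem sum_selfNegative [NeZero k] [DecidableEq (Fin (n + 2) → ZMod k)] :
    ∑ e : Fin (n + 2) → ZMod k with -e = e, e 0 = 0 := by
  have h10 : (1 : Fin (n + 2)) ≠ 0 := by simp
  have hsingle : ∀ e : Fin (n + 2) → ZMod k, -e = e →
      -(Pi.single 1 (e 0) : Fin (n + 2) → ZMod k) = Pi.single 1 (e 0) := fun e he => by
    rw [← Pi.single_neg]
    congr 1
    exact congrFun he 0
  refine Finset.sum_involution (fun e _ => e + Pi.single 1 (e 0)) ?_ ?_ ?_ ?_
  · intro e he
    have := congrFun (Finset.mem_filter.1 he).2 0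
    simp only [Pi.neg_apply] at this
    simp only [Pi.add_apply, Pi.single_eq_of_ne h10.symm, add_zero]
    nth_rw 1 [← this]
    exact neg_add_cancel _
  · intro e _ h0 heq
    have := congrFun heq 1
    simp only [Pi.add_apply, Pi.single_eq_same, add_eq_left] at this
    exact h0 this
  · intro e he
    have := (Finset.mem_filter.1 he).2
    rw [Finset.mem_filter]
    refine ⟨Finset.mem_univ _, ?_⟩
    rw [neg_add, this, hsingle e this]
  · intro e he
    have := hsingle e (Finset.mem_filter.1 he).2
    simp only [Pi.add_apply, Pi.single_eq_of_ne h10.symm, add_zero, add_assoc]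
    nth_rw 1 [← this]
    simp

theorem Subgraph.IsEulerianCircuit.sum_eq_zero [NeZero k] {a : ℕ → ZMod k} {L : ℕ}
    (ha : (graphT k (n + 1)).IsEulerianCircuit a L) : ∑ j ∈ Finset.range L, a j = 0 := by
  classical
  rw [← sum_selfNegative (n := n)]
  refine Finset.sum_bij (fun i _ => window a (n + 2) i) ?_ ?_ ?_ ?_
  · intro i hi
    rw [Finset.mem_filter]
    exact ⟨Finset.mem_univ _, ha.bijOn.mapsTo (Finset.mem_range.1 hi)⟩
  · intro i hi j hj h
    exact ha.bijOn.injOn (Finset.mem_range.1 hi) (Finset.mem_range.1 hj) h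
  · intro e he
    obtain ⟨i, hi, rfl⟩ := ha.bijOn.surjOn (Finset.mem_filter.1 he).2
    exact ⟨i, Finset.mem_range.2 hi, rfl⟩
  · intro i _
    simp [window]

/-! ### The graph `Z_k(n)` -/

/-- `0 < x < k / 2`. -/
def IsPos (x : ZMod k) : Prop := 0 < x.val ∧ 2 * x.val < k

theorem IsPos.ne_zero {x : ZMod k} (h : IsPos x) : x ≠ 0 := by
  rintro rfl
  simp [IsPos] at h

theorem isPos_neg_iff [NeZero k] {x : ZMod k} : IsPos (-x) ↔ x ≠ 0 ∧ k < 2 * x.val := by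
  have := ZMod.val_lt x
  have := ZMod.val_eq_zero x
  unfold IsPos
  rw [ZMod.neg_val]
  split_ifs with h
  · simp [h]
  · simp only [h, iff_false] at this
    simp only [Ne, h, not_false_eq_true, true_and]
    omega

theorem neg_eq_self_iff_val {x : ZMod k} : -x = x ↔ x.val = 0 ∨ 2 * x.val = k := by
  rw [ZMod.neg_eq_self_iff, ZMod.val_eq_zero]

theorem IsPos.neg_ne [NeZero k] {x : ZMod k} (h : IsPos x) : -x ≠ x := by
  rw [Ne, neg_eq_self_iff_val]
  unfold IsPos at h
  omega

theorem isPos_iff_not_neg [NeZero k] {x : ZMod k} (h : -x ≠ x) : IsPos x ↔ ¬ IsPos (-x) := by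
  rw [isPos_neg_iff]
  rw [Ne, neg_eq_self_iff_val] at h
  rw [Ne, ← ZMod.val_eq_zero]
  unfold IsPos
  omega

/-- The edges of the circuits `a_x` for `0 < x < k/2`. -/
def posLifts (n : ℕ) (a : ℕ → ZMod k) : Set (Fin (n + 1) → ZMod k) :=
  {e | ∃ x i, IsPos x ∧ window (lift a x) (n + 1) i = e}

theorem edges_graphZ [NeZero k] (𝒮 : Set (Set (Fin (n + 1) → ZMod k))) (a : ℕ → ZMod k) :
    (graphZ k n 𝒮 a).edges = {e | lempel e ∈ edgesF k (n + 1) 𝒮} ∪ posLifts (n + 1) a := by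
  change _ ∪ _ = _ ∪ _
  congr 1
  ext e
  constructor
  · rintro ⟨x, h0, hx, i, hi⟩
    have : (x : ZMod k).val = x := ZMod.val_cast_of_lt (by omega)
    exact ⟨x, i, ⟨by omega, by omega⟩, hi⟩
  · rintro ⟨x, i, hx, hi⟩
    exact ⟨x.val, hx.1, hx.2, i, by rw [ZMod.natCast_zmod_val]; exact hi⟩

section Z

variable {𝒮 : Set (Set (Fin (n + 2) → ZMod k))} {a : ℕ → ZMod k} {L : ℕ}

/-- The successor is rotation lifted through `D`: the appended entry makes the new last difference
equal to the old first one. -/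
theorem hasSuccession_lempelPreimage {F : Set (Fin (n + 2) → ZMod k)}
    (hF : ∀ e ∈ F, rotate e ∈ F) : HasSuccession {e | lempel e ∈ F} := by
  have hD : ∀ e : Fin (n + 3) → ZMod k, lempel (Fin.snoc (Fin.tail e)
      (e (Fin.last _) + lempel e 0) : Fin (n + 3) → ZMod k) = rotate (lempel e) := by
    intro e
    ext i
    induction i using Fin.lastCases with
    | last => simp [lempel, rotate, Fin.tail]
    | cast i =>
      simp only [lempel, rotate, Fin.succ_castSucc, Fin.snoc_castSucc, Fin.tail]
      simp
  refine ⟨fun e => Fin.snoc (Fin.tail e) (e (Fin.last _) + lempel e 0), fun e he => ?_,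
    fun e _ e' _ h => ?_, fun e _ => Fin.init_snoc _ _⟩
  · change lempel _ ∈ F
    rw [hD]
    exact hF _ he
  · have h1 := congrArg lempel h
    simp only [hD] at h1
    have h2 := rotate_injective h1
    have h3 := congrArg Fin.init h
    simp only [Fin.init_snoc] at h3
    -- The tails agree, and so do the first differences, hence the first entries.
    refine eq_of_lempel_eq ?_ h2
    have h4 := congrFun h3 0
    have h5 := congrFun h2 0
    simp only [Fin.tail, lempel, Fin.castSucc_zero] at h4 h5
    rw [h4] at h5
    exact sub_right_injective h5

/-- The successor of a window is the next window of the same lift; the choice of position matters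
only modulo `L`. -/
theorem hasSuccession_posLifts (ha : IsWindowSeq n a L) (hsum : ∑ j ∈ Finset.range L, a j = 0) :
    HasSuccession (posLifts n a) := by
  choose! x i hx using fun e (h : e ∈ posLifts n a) => h
  refine ⟨fun e => window (lift a (x e)) (n + 1) (i e + 1), fun e he => ?_,
    fun e he e' he' h => ?_, fun e he => ?_⟩
  · exact ⟨_, _, (hx e he).1, rfl⟩
  · obtain ⟨h1, h2⟩ := (window_lift_eq_iff ha hsum).1 h
    rw [← (hx e he).2, ← (hx e' he').2, window_lift_eq_iff ha hsum]
    exact ⟨Nat.ModEq.add_right_cancel' 1 h1, h2⟩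
  · rw [init_window, ← tail_window, (hx e he).2]

theorem neg_lempel_eq_self_of_mem_posLifts (ha : (graphT k (n + 1)).IsEulerianCircuit a L)
    {e : Fin (n + 3) → ZMod k} (he : e ∈ posLifts (n + 2) a) : -lempel e = lempel e := by
  obtain ⟨x, i, -, rfl⟩ := he
  rw [lempel_window_lift]
  change window a (n + 2) i ∈ (graphT k (n + 1)).edges
  rw [← (Subgraph.isEulerianCircuit_iff.1 ha).2]
  exact ⟨i, rfl⟩

theorem hasSuccession_graphZ [NeZero k] (hn : Odd (n + 2)) (h𝒮 : IsSelection k (n + 2) 𝒮)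
    (ha : (graphT k (n + 1)).IsEulerianCircuit a L) :
    HasSuccession (graphZ k (n + 1) 𝒮 a).edges := by
  rw [edges_graphZ]
  refine (hasSuccession_lempelPreimage fun _ => rotate_mem_edgesF h𝒮).union
    (hasSuccession_posLifts (Subgraph.isEulerianCircuit_iff.1 ha).1 ha.sum_eq_zero) ?_
  rw [Set.disjoint_left]
  intro e he he'
  exact (isHalf_edgesF hn h𝒮).1 _ he (neg_lempel_eq_self_of_mem_posLifts ha he')

theorem isHalf_graphZ [NeZero k] (hn : Odd (n + 2)) (h𝒮 : IsSelection k (n + 2) 𝒮)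
    (ha : (graphT k (n + 1)).IsEulerianCircuit a L) :
    IsHalf (graphZ k (n + 1) 𝒮 a).edges := by
  obtain ⟨hw, hr⟩ := Subgraph.isEulerianCircuit_iff.1 ha
  have hF := isHalf_edgesF hn h𝒮
  have hself : ∀ i, -a i = a i := fun i => by
    have : window a (n + 2) i ∈ (graphT k (n + 1)).edges := hr ▸ ⟨i, rfl⟩
    exact congrFun this 0
  have hmem : ∀ x i, window (lift a x) (n + 3) i ∈ posLifts (n + 2) a ↔ IsPos x := fun x i =>
    ⟨fun ⟨y, j, hy, hj⟩ => ((window_lift_eq_iff hw ha.sum_eq_zero).1 hj).2 ▸ hy,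
      fun h => ⟨x, i, h, rfl⟩⟩
  have hneg : ∀ x i, -window (lift a x) (n + 3) i = window (lift a (-x)) (n + 3) i := fun x i => by
    ext t
    exact neg_lift hself x _
  rw [edges_graphZ]
  constructor
  · rintro e (he | ⟨x, i, hx, rfl⟩) h
    · exact hF.1 _ he (by rw [← lempel_neg, h])
    · rw [hneg, window_lift_eq_iff hw ha.sum_eq_zero] at h
      exact hx.neg_ne h.2
  · intro e he
    have hsplit : ∀ e' : Fin (n + 3) → ZMod k,
        e' ∈ {e | lempel e ∈ edgesF k (n + 2) 𝒮} ∪ posLifts (n + 2) a ↔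
          lempel e' ∈ edgesF k (n + 2) 𝒮 ∨ e' ∈ posLifts (n + 2) a := fun _ => Iff.rfl
    rw [hsplit, hsplit]
    -- If `D e` is self-negative, `e` lies on a lift `a_x` and `-e` on `a_{-x}`, and the sign of `x`
    -- decides. Otherwise only the preimage of `W` is involved.
    by_cases hD : -lempel e = lempel e
    · obtain ⟨i, hi⟩ : lempel e ∈ Set.range (window a (n + 2)) := hr ▸ hD
      obtain ⟨x, rfl⟩ := exists_window_lift_eq hi.symm
      have h1 : lempel (window (lift a x) (n + 3) i) ∉ edgesF k (n + 2) 𝒮 := fun h => hF.1 _ h hD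
      have h2 : lempel (-window (lift a x) (n + 3) i) ∉ edgesF k (n + 2) 𝒮 := by
        rwa [lempel_neg, hD]
      simp only [h1, h2, false_or]
      rw [hneg, hmem, hmem]
      refine isPos_iff_not_neg fun hx => he ?_
      rw [hneg, hx]
    · have h1 : e ∉ posLifts (n + 2) a := fun h => hD (neg_lempel_eq_self_of_mem_posLifts ha h)
      have h2 : -e ∉ posLifts (n + 2) a := fun h => hD (by
        have := neg_lempel_eq_self_of_mem_posLifts ha h
        rw [lempel_neg, neg_neg] at this
        exact this.symm)
      simp only [h1, h2, or_false, lempel_neg]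
      exact hF.2 _ hD

/-- `D v` is a vertex of `W` or a self-negative tuple, and in both cases 1 can be appended. -/
theorem snoc_lempel_one_mem_edgesF (hk : 3 ≤ k) (h𝒮 : IsSelection k (n + 2) 𝒮)
    (ha : (graphT k (n + 1)).IsEulerianCircuit a L) {v : Fin (n + 2) → ZMod k}
    (hv : v ∈ (graphZ k (n + 1) 𝒮 a).verts) :
    (Fin.snoc (lempel v) 1 : Fin (n + 2) → ZMod k) ∈ edgesF k (n + 2) 𝒮 := by
  have : NeZero k := ⟨by omega⟩
  obtain ⟨e, he, hev⟩ := hv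
  have he' := he
  change e ∈ (graphZ k (n + 1) 𝒮 a).edges at he'
  rw [edges_graphZ] at he'
  rcases he' with he' | he'
  · apply snoc_one_mem_edgesF_of_mem_verts hk h𝒮
    rcases hev with rfl | rfl
    · rw [lempel_init]; exact (graphW k (n + 1) 𝒮).init_mem _ he'
    · rw [lempel_tail]; exact (graphW k (n + 1) 𝒮).tail_mem _ he'
  · apply snoc_one_mem_edgesF_of_neg_eq_self hk
    have := neg_lempel_eq_self_of_mem_posLifts ha he'
    apply neg_eq_self_of_mem_verts_graphT
    rcases hev with rfl | rfl
    · rw [lempel_init]; exact (graphT k (n + 1)).init_mem _ this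
    · rw [lempel_tail]; exact (graphT k (n + 1)).tail_mem _ this

theorem isConnected_graphZ (hk : 3 ≤ k) (h𝒮 : IsSelection k (n + 2) 𝒮)
    (ha : (graphT k (n + 1)).IsEulerianCircuit a L) :
    (graphZ k (n + 1) 𝒮 a).IsConnected := by
  have : NeZero k := ⟨by omega⟩
  have key : ∀ v ∈ (graphZ k (n + 1) 𝒮 a).verts,
      Relation.EqvGen (graphZ k (n + 1) 𝒮 a).Adj v (fun i : Fin (n + 2) => ((i : ℕ) : ZMod k)) := by
    intro v hv
    obtain ⟨s, h0, h1, hs⟩ := exists_word (snoc_lempel_one_mem_edgesF hk h𝒮 ha hv)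
      (fun v => tail_snoc_one_mem_edgesF hk h𝒮)
    have hv0 : window (lift s (v 0)) (n + 2) 0 = v :=
      eq_of_lempel_eq (by simp [window, lift]) (by rw [lempel_window_lift, h0])
    have hlift : ∀ j : ℕ, lift s (v 0) (n + 1 + j) = lift s (v 0) (n + 1) + j := by
      intro j
      induction j with
      | zero => simp
      | succ j ih => rw [← add_assoc, lift_succ, ih, h1 _ (by omega)]; push_cast; ring
    -- From position `n + 1` on, the lift grows by 1 at each step; this many further steps bring its
    -- value to 0.
    have hz : window (lift s (v 0)) (n + 2) (n + 1 + (-lift s (v 0) (n + 1)).val) =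
        fun i : Fin (n + 2) => ((i : ℕ) : ZMod k) := by
      ext t
      simp only [window, add_assoc (n + 1)]
      rw [hlift]
      simp
    rw [← hz]
    nth_rw 1 [← hv0]
    refine Subgraph.eqvGen_window (T := graphZ k (n + 1) 𝒮 a) (s := lift s (v 0)) (fun i => ?_) _
    left
    change lempel _ ∈ edgesF k (n + 2) 𝒮
    rw [lempel_window_lift]
    exact hs i
  have hmem : (Fin.snoc (0 : Fin (n + 1) → ZMod k) 1 : Fin (n + 2) → ZMod k) ∈
      edgesF k (n + 2) 𝒮 := snoc_one_mem_edgesF_of_neg_eq_self hk neg_zero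
  have hedge : window (lift (Function.update 0 (n + 1) 1) 0) (n + 3) 0 ∈
      (graphZ k (n + 1) 𝒮 a).edges := by
    left
    change lempel _ ∈ edgesF k (n + 2) 𝒮
    rw [lempel_window_lift, ← snoc_window]
    convert hmem using 2
    · ext t
      simp [window, Function.update_of_ne t.2.ne]
    · simp
  exact ⟨⟨_, Subgraph.init_mem _ _ hedge⟩,
    fun u hu v hv => (key u hu).trans _ _ _ (key v hv).symm⟩

end Z

/-! ### Span two -/

/-- A relation on `ℤ_k` that holds for exactly one of `(x, y)` and `(-x, -y)`, unless both `x` and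
`y` are self-negative. -/
def PairRel (x y : ZMod k) : Prop :=
  (IsPos x ∧ IsPos y) ∨ (x = 0 ∧ IsPos y) ∨ (IsPos (-x) ∧ y = 0) ∨ (IsPos x ∧ y = -x) ∨
  (IsPos x ∧ IsPos (-y) ∧ x.val < (-y).val) ∨ (IsPos (-x) ∧ IsPos y ∧ y.val < (-x).val) ∨
  (x ≠ 0 ∧ -x = x ∧ IsPos y) ∨ (IsPos x ∧ y ≠ 0 ∧ -y = y)

/-- The edges `(x, y)` with `PairRel x y`. -/
def pairs (k : ℕ) : Set (Fin 2 → ZMod k) := {e | PairRel (e 0) (e 1)}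

/-- The second component of the successor of the edge `(x, y)`. -/
def pairNext [NeZero k] (x y : ZMod k) : ZMod k :=
  if x = 0 then -y else if y = 0 then -x else if y = -x then 0 else x

section

variable [NeZero k]

/-- The edges form triangles `0 → y → -y → 0` for positive `y`, and otherwise 2-cycles `x → y → x`
and loops. The triangles are needed because the negative of `(y, -y)` is its own reversal, so no
symmetric relation can contain exactly one of the two. -/
theorem PairRel.next {x y : ZMod k} (h : PairRel x y) : PairRel y (pairNext x y) := by
  have hx := @IsPos.neg_ne k _ x
  have hx' := @IsPos.neg_ne k _ (-x)
  have hy := @IsPos.neg_ne k _ y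
  have h0 : ¬ IsPos (0 : ZMod k) := fun h => h.ne_zero rfl
  have hx0 := isPos_iff_not_neg (x := x)
  have hy0 := isPos_iff_not_neg (x := y)
  have hnx := neg_neg x
  have hny := neg_neg y
  have hn0 : -(0 : ZMod k) = 0 := neg_zero
  rw [neg_neg] at hx'
  unfold pairNext PairRel at *
  split_ifs with h1 h2 h3
  · subst h1; grind
  · subst h2; grind
  · subst h3; grind
  · grind

theorem PairRel.eq_of_next_eq {x x' y : ZMod k} (h : PairRel x y)
    (heq : pairNext x y = pairNext x' y) : x = x' := by
  have hy := @IsPos.neg_ne k _ y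
  have hy' := @IsPos.neg_ne k _ (-y)
  have h0 : ¬ IsPos (0 : ZMod k) := fun h => h.ne_zero rfl
  have hy0 := isPos_iff_not_neg (x := y)
  have hny := neg_neg y
  have hn0 : -(0 : ZMod k) = 0 := neg_zero
  rw [neg_neg] at hy'
  unfold pairNext PairRel at *
  grind

theorem isHalf_pairs : IsHalf (pairs k) := by
  have h0 : ¬ IsPos (0 : ZMod k) := fun h => h.ne_zero rfl
  constructor
  · intro e he hself
    have h1 := congrFun hself 0
    have h2 := congrFun hself 1
    have hx := @IsPos.neg_ne k _ (e 0)
    have hy := @IsPos.neg_ne k _ (e 1)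
    simp only [Pi.neg_apply] at h1 h2
    unfold pairs at he
    change PairRel _ _ at he
    unfold PairRel at he
    grind
  · intro e he
    change PairRel (e 0) (e 1) ↔ ¬ PairRel (-e 0) (-e 1)
    have he' : -e 0 ≠ e 0 ∨ -e 1 ≠ e 1 := by
      by_contra! h
      apply he
      ext i
      fin_cases i
      · exact h.1
      · exact h.2
    generalize e 0 = x at *
    generalize e 1 = y at *
    have hx := @IsPos.neg_ne k _ x
    have hy := @IsPos.neg_ne k _ y
    have hx0 := isPos_iff_not_neg (x := x)
    have hy0 := isPos_iff_not_neg (x := y)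
    -- Entries of opposite sign are compared by size; a tie means `y = -x`, which has its own clause
    -- in `PairRel`.
    have hv : x.val = (-y).val ↔ x = -y := (ZMod.val_injective k).eq_iff
    have hv' : y.val = (-x).val ↔ y = -x := (ZMod.val_injective k).eq_iff
    have hneg : -(0 : ZMod k) = 0 := neg_zero
    unfold PairRel
    simp only [neg_neg]
    grind

theorem hasSuccession_pairs : HasSuccession (pairs k) := by
  refine ⟨fun e => ![e 1, pairNext (e 0) (e 1)], fun e he => PairRel.next he,
    fun e he e' he' h => ?_, fun e _ => ?_⟩
  · have h1 : e 1 = e' 1 := congrFun h 0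
    have h2 : pairNext (e 0) (e 1) = pairNext (e' 0) (e' 1) := congrFun h 1
    change PairRel _ _ at he he'
    rw [← h1] at h2 he'
    ext i
    fin_cases i
    · exact he.eq_of_next_eq h2
    · exact h1
  · ext i
    fin_cases i
    rfl

end

/-- Positive and negative vertices are adjacent to 0, and for even `k` the vertex `k/2` is joined to
0 through 1. -/
theorem isConnected_pairs (hk : 3 ≤ k) : (Subgraph.ofEdges (pairs k)).IsConnected := by
  have : NeZero k := ⟨by omega⟩
  have : Fact (1 < k) := ⟨by omega⟩
  have hadj : ∀ x y : ZMod k, PairRel x y →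
      (Subgraph.ofEdges (pairs k)).Adj (fun _ => x) (fun _ => y) := fun x y h =>
    ⟨![x, y], h, by ext i; fin_cases i; rfl, by ext i; fin_cases i; rfl⟩
  have hpos : ∀ x : ZMod k, IsPos x →
      Relation.EqvGen (Subgraph.ofEdges (pairs k)).Adj (fun _ => x) (fun _ => 0) := fun x hx =>
    .symm _ _ (.rel _ _ (hadj _ _ (Or.inr (Or.inl ⟨rfl, hx⟩))))
  have hone : IsPos (1 : ZMod k) := by
    rw [IsPos, ZMod.val_one]; omega
  have key : ∀ x : ZMod k,
      Relation.EqvGen (Subgraph.ofEdges (pairs k)).Adj (fun _ => x) (fun _ => 0) := by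
    intro x
    by_cases h0 : x = 0
    · rw [h0]; exact .refl _
    by_cases hs : -x = x
    · refine .trans _ _ _ (.rel _ _ (hadj x 1 ?_)) (hpos 1 hone)
      unfold PairRel
      tauto
    by_cases hx : IsPos x
    · exact hpos x hx
    · have hx' : IsPos (-x) := by_contra fun h => hx ((isPos_iff_not_neg hs).2 h)
      exact .rel _ _ (hadj x 0 (Or.inr (Or.inr (Or.inl ⟨hx', rfl⟩))))
  have hc : ∀ v : Fin 1 → ZMod k, v = fun _ => v 0 := fun v => by
    ext i; rw [Subsingleton.elim i 0]
  refine ⟨⟨fun _ => 0, ![0, 1], Or.inr (Or.inl ⟨rfl, hone⟩), Or.inl ?_⟩, fun u _ v _ => ?_⟩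
  · ext i; fin_cases i; rfl
  · rw [hc u, hc v]
    exact (key _).trans _ _ _ (key _).symm

theorem exists_isMaximalNAS_two (hk : 3 ≤ k) : ∃ s : ℕ → ZMod k, IsMaximalNAS 2 s := by
  have : NeZero k := ⟨by omega⟩
  obtain ⟨s, hs, -⟩ := Subgraph.exists_isMaximalNAS (T := Subgraph.ofEdges (pairs k)) hk
    isHalf_pairs hasSuccession_pairs (isConnected_pairs hk)
  exact ⟨s, hs⟩

/-! ### All spans -/

theorem exists_isMaximalNAS (hk : 3 ≤ k) {n : ℕ} (hn : 2 ≤ n) :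
    ∃ s : ℕ → ZMod k, IsMaximalNAS n s := by
  have : NeZero k := ⟨by omega⟩
  obtain rfl | hn' := hn.eq_or_lt
  · exact exists_isMaximalNAS_two hk
  rcases Nat.even_or_odd n with he | ho
  -- An even span `m + 3` is lifted by `D` from tuples of odd length `m + 2`.
  · obtain ⟨m, rfl⟩ : ∃ m, n = m + 3 := ⟨n - 3, by omega⟩
    have hodd : Odd (m + 2) := by
      rw [← Nat.not_even_iff_odd]
      exact Nat.even_add_one.1 he
    obtain ⟨𝒮, h𝒮⟩ := exists_isSelection (k := k) hodd
    obtain ⟨a, L, ha⟩ := exists_isEulerianCircuit_graphT (k := k) (n := m)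
    obtain ⟨s, hs, -⟩ := Subgraph.exists_isMaximalNAS hk (isHalf_graphZ hodd h𝒮 ha)
      (hasSuccession_graphZ hodd h𝒮 ha) (isConnected_graphZ hk h𝒮 ha)
    exact ⟨s, hs⟩
  · obtain ⟨m, rfl⟩ : ∃ m, n = m + 2 := ⟨n - 2, by omega⟩
    obtain ⟨𝒮, h𝒮⟩ := exists_isSelection (k := k) ho
    obtain ⟨s, hs, -⟩ := Subgraph.exists_isMaximalNAS (T := graphW k (m + 1) 𝒮) hk
      (isHalf_edgesF ho h𝒮) (hasSuccession_of_rotate fun _ => rotate_mem_edgesF h𝒮)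
      (isConnected_graphW hk h𝒮)
    exact ⟨s, hs⟩

end NAS

theorem mainTheorem1 (k : ℕ) (hk : 3 ≤ k) :
    -- here `n = m + 1` is odd and at least `3`
    (∀ m : ℕ, 3 ≤ m + 1 → Odd (m + 1) →
      (∃ 𝒮, NAS.IsSelection k (m + 1) 𝒮) ∧
      (∃ a L, (NAS.graphT k m).IsEulerianCircuit a L) ∧
      ∀ (𝒮 : Set (Set (Fin (m + 1) → ZMod k))), NAS.IsSelection k (m + 1) 𝒮 →
      ∀ (a : ℕ → ZMod k) (L : ℕ), (NAS.graphT k m).IsEulerianCircuit a L →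
        (NAS.graphZ k m 𝒮 a).IsAntinegative ∧
        (NAS.graphZ k m 𝒮 a).IsEulerian ∧
        (NAS.graphZ k m 𝒮 a).edges.ncard
          = (k ^ (m + 2) - NAS.delta k ^ (m + 2)) / 2 ∧
        ∃ s : ℕ → ZMod k, NAS.IsMaximalNAS (m + 2) s ∧
          Set.range (NAS.window s (m + 2)) = (NAS.graphZ k m 𝒮 a).edges) ∧
    (∀ n : ℕ, 2 ≤ n → ∃ s : ℕ → ZMod k, NAS.IsMaximalNAS n s) := by
  have : NeZero k := ⟨by omega⟩
  refine ⟨fun m hm hodd => ?_, fun n hn => NAS.exists_isMaximalNAS hk hn⟩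
  obtain ⟨n, rfl⟩ : ∃ n, m = n + 1 := ⟨m - 1, by omega⟩
  refine ⟨NAS.exists_isSelection hodd, NAS.exists_isEulerianCircuit_graphT,
    fun 𝒮 h𝒮 a L ha => ?_⟩
  have hh := NAS.isHalf_graphZ hodd h𝒮 ha
  have hs := NAS.hasSuccession_graphZ hodd h𝒮 ha
  have hc := NAS.isConnected_graphZ hk h𝒮 ha
  exact ⟨NAS.Subgraph.isAntinegative_of_isHalf hh,
    ⟨hc, NAS.Subgraph.isBalanced_of_hasSuccession hs⟩, hh.ncard_eq hk (by omega),
    NAS.Subgraph.exists_isMaximalNAS hk hh hs hc⟩
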